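/- A \emph{poc set} is a partially ordered set $(P,\le)$ with a minimum element $0$ and an order-reversing involution $a\mapsto a^*$ such that $a\le a^*$ only for $a=0$. An element is \emph{proper} if it is different from $0$ and $0^*$, and $P$ is \emph{discrete} if the intervals $\{x: a\le x\le b\}$ are finite for all proper $a,b\in P$. A \emph{complete $*$-selection} on $P$ is a subset $U\subseteq P$ containing exactly one of $a,a^*$ for every $a\in P$; it is \emph{coherent} (an \emph{ultrafilter}) if $a\le b^*$ never holds for $a,b\in U$. Let $P$ be a discrete poc set and let $B$ be an ultrafilter on $P$. Represent every complete $*$-selection $U$ by the indicator function $\rho(U)\in\{0,1\}^B$ of $B\smallsetminus U$, a vertex of the cube $[0,1]^B$. Let $\mathcal C(P)$ be the cubical complex formed by the finite-dimensional faces of $[0,1]^B$ all of whose vertices represent coherent $*$-selections, and let $\mathcal C(P)_B$ be its connected component containing $\rho(B)$. The \emph{unit piecewise-$\ell^\infty$ cubing} $\mathcal C^\infty(P)_B$ is $\mathcal C(P)_B$ with the quotient metric obtained from the disjoint union of its cubes, each with the metric induced by $\|\cdot\|_\infty$ (points of distinct cubes being at infinite distance): the distance of $\xi,\eta$ is the infimum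 of the sums $\sum_{i=0}^n d(x_i,y_i)$, where $x_0$ represents $\xi$, $y_n$ represents $\eta$, and $y_{i-1},x_i$ represent the same point for $1\le i\le n$. The cubing is \emph{finite} if it has finitely many cubes. A metric space $X$ is \emph{injective} if for every isometric embedding $i:A\to E$ of metric spaces and every non-expansive map $f:A\to X$ there is a non-expansive map $F:E\to X$ with $F\circ i=f$. \textbf{Proposition.} Every finite unit piecewise-$\ell^\infty$ cubing is injective. -/

import Mathlib

open scoped ENNReal

universe u v w

noncomputable section

/-- A metric space `X` is injective if every non-expansive map `f : A → X` extends along every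
isometric embedding `i : A → E` to a non-expansive map `F : E → X`. -/
def IsInjectiveMetricSpace (X : Type u) [MetricSpace X] : Prop :=
  ∀ (A : Type v) (E : Type w) [MetricSpace A] [MetricSpace E] (i : A → E) (f : A → X),
    Isometry i → LipschitzWith 1 f → ∃ F : E → X, LipschitzWith 1 F ∧ F ∘ i = f

section QuotientMetric

variable {X Y : Type*}

/-- `ChainLength d π ξ η s` says that `s = d x₀ y₀ + ⋯ + d xₙ yₙ` for some points of `X` with
`π x₀ = ξ`, `π yₙ = η` and `π yᵢ₋₁ = π xᵢ` for `1 ≤ i ≤ n`. -/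
inductive ChainLength (d : X → X → ℝ≥0∞) (π : X → Y) : Y → Y → ℝ≥0∞ → Prop
  | single (x y : X) : ChainLength d π (π x) (π y) (d x y)
  | cons (x y : X) (η : Y) (s : ℝ≥0∞) (h : ChainLength d π (π y) η s) :
      ChainLength d π (π x) η (d x y + s)

/-- The quotient (semi-)distance on `Y`, regarded as the set of blocks of the partition of `X`
into the fibres of `π : X → Y`. -/
def quotientEDist (d : X → X → ℝ≥0∞) (π : X → Y) (ξ η : Y) : ℝ≥0∞ :=
  sInf {s | ChainLength d π ξ η s}

theorem ChainLength.append {d : X → X → ℝ≥0∞} {π : X → Y} {ξ η ζ : Y} {s t : ℝ≥0∞}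
    (h : ChainLength d π ξ η s) (h' : ChainLength d π η ζ t) :
    ChainLength d π ξ ζ (s + t) := by
  induction h with
  | single x y => exact .cons x y _ _ h'
  | cons x y η s _ ih => rw [add_assoc]; exact .cons x y _ _ (ih h')

theorem ChainLength.reverse {d : X → X → ℝ≥0∞} (hd : ∀ x y, d x y = d y x) {π : X → Y}
    {ξ η : Y} {s : ℝ≥0∞} (h : ChainLength d π ξ η s) : ChainLength d π η ξ s := by
  induction h with
  | single x y => rw [hd]; exact .single y x
  | cons x y η s _ ih =>
    rw [add_comm, hd]
    exact ih.append (.single y x)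

theorem quotientEDist_comm {d : X → X → ℝ≥0∞} (hd : ∀ x y, d x y = d y x) (π : X → Y)
    (ξ η : Y) : quotientEDist d π ξ η = quotientEDist d π η ξ := by
  unfold quotientEDist
  congr 1
  ext s
  exact ⟨fun h => h.reverse hd, fun h => h.reverse hd⟩

theorem quotientEDist_triangle (d : X → X → ℝ≥0∞) (π : X → Y) (ξ η ζ : Y) :
    quotientEDist d π ξ ζ ≤ quotientEDist d π ξ η + quotientEDist d π η ζ := by
  unfold quotientEDist
  rw [ENNReal.sInf_add]
  refine le_iInf₂ fun s hs => ?_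
  rw [add_comm, ENNReal.sInf_add]
  refine le_iInf₂ fun t ht => ?_
  rw [add_comm]
  exact sInf_le (ChainLength.append hs ht)

end QuotientMetric

/-- A poc set: a poset with a minimum `⊥` and an order-reversing involution `a ↦ star a` such that
`a ≤ star a` only for `a = ⊥`. -/
class PocSet (P : Type*) extends PartialOrder P, OrderBot P, InvolutiveStar P where
  star_le_star_of_le : ∀ a b : P, a ≤ b → star b ≤ star a
  eq_bot_of_le_star : ∀ a : P, a ≤ star a → a = ⊥

namespace PocSet

variable {P : Type*} [PocSet P]

/-- The proper (non-trivial) elements of a poc set. -/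
def IsProper (a : P) : Prop := a ≠ ⊥ ∧ a ≠ star ⊥

variable (P) in
/-- A poc set is discrete if the order intervals between its proper elements are finite. -/
def IsDiscrete : Prop := ∀ a b : P, IsProper a → IsProper b → (Set.Icc a b).Finite

/-- Complete `∗`-selections: exactly one of `a`, `star a` is selected, for every `a`. -/
def IsStarSelection (U : Set P) : Prop := ∀ a : P, Xor (a ∈ U) (star a ∈ U)

/-- Coherent subsets. -/
def IsCoherent (U : Set P) : Prop := ∀ a ∈ U, ∀ b ∈ U, ¬ a ≤ star b

variable (P) in
/-- The ultrafilters on a poc set, that is, its coherent complete `∗`-selections. -/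
structure Ultra where
  carrier : Set P
  isStarSelection : IsStarSelection carrier
  isCoherent : IsCoherent carrier

variable (B : Ultra P)

open Classical in
/-- The vertex of the cube `[0,1]^B` that represents the `∗`-selection `U`: the indicator function
of `B \ U`. It maps `B` to the origin, and it is a bijection from the complete `∗`-selections onto
the `{0,1}`-valued functions on `B`. -/
def vertex (U : Set P) : B.carrier → ℝ := fun b => if (b : P) ∈ U then 0 else 1

/-- The face of `[0,1]^B` that contains the vertex of `U` and has the free coordinates `A`. -/
def face (U : Set P) (A : Set B.carrier) : Set (B.carrier → ℝ) :=
  {x | (∀ b, x b ∈ Set.Icc (0 : ℝ) 1) ∧ ∀ b, b ∉ A → x b = vertex B U b}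

/-- The cubes of the dual complex of `P`, realized in `[0,1]^B`: the finite-dimensional faces of
`[0,1]^B` all of whose vertices represent coherent `∗`-selections. -/
def IsCube (Q : Set (B.carrier → ℝ)) : Prop :=
  ∃ (U : Set P) (A : Set B.carrier), IsStarSelection U ∧ A.Finite ∧ Q = face B U A ∧
    ∀ V : Set P, IsStarSelection V → vertex B V ∈ Q → IsCoherent V

/-- Two points lie in a common cube of the dual complex. -/
def ShareCube (x y : B.carrier → ℝ) : Prop := ∃ Q, IsCube B Q ∧ x ∈ Q ∧ y ∈ Q

/-- The connected component of the dual complex that contains the vertex `B`: the points that can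
be reached from this vertex by a finite sequence of points in which consecutive points lie in a
common cube. -/
def component : Set (B.carrier → ℝ) :=
  {x | Relation.TransGen (ShareCube B) (vertex B B.carrier) x}

/-- The underlying set of the unit cubing dual to `P` with basepoint `B`. -/
def Cubing : Type _ := component B

/-- The cubes of this cubing. -/
def Cube : Type _ := {Q : Set (B.carrier → ℝ) // IsCube B Q ∧ Q ⊆ component B}

/-- The disjoint union of the cubes. -/
def CubeUnion : Type _ := Σ Q : Cube B, Q.1

variable {B}

open Classical in
/-- The `ℓ^∞` distance within each cube; points of distinct cubes are at infinite distance. -/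
def cubeEDist (p q : CubeUnion B) : ℝ≥0∞ :=
  if p.1 = q.1 then ⨆ b, edist (p.2.1 b) (q.2.1 b) else ⊤

/-- The projection of the disjoint union of the cubes onto the cubing. -/
def cubeProj (p : CubeUnion B) : Cubing B := ⟨p.2.1, p.1.2.2 p.2.2⟩

theorem IsCube.subset_component {Q : Set (B.carrier → ℝ)} (hQ : IsCube B Q)
    {x : B.carrier → ℝ} (hx : x ∈ Q) (hxc : x ∈ component B) : Q ⊆ component B :=
  fun _ hy => Relation.TransGen.tail hxc ⟨Q, hQ, hx, hy⟩

theorem exists_cube (x : Cubing B) : ∃ Q : Cube B, x.1 ∈ Q.1 := by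
  obtain ⟨x, hx⟩ := x
  obtain ⟨Q, hQ, hxQ⟩ : ∃ Q, IsCube B Q ∧ x ∈ Q := by
    cases hx with
    | single h => obtain ⟨Q, hQ, _, h⟩ := h; exact ⟨Q, hQ, h⟩
    | tail _ h => obtain ⟨Q, hQ, _, h⟩ := h; exact ⟨Q, hQ, h⟩
  exact ⟨⟨Q, hQ, hQ.subset_component hxQ hx⟩, hxQ⟩

theorem cubeEDist_comm (p q : CubeUnion B) : cubeEDist p q = cubeEDist q p := by
  unfold cubeEDist
  by_cases h : p.1 = q.1
  · rw [if_pos h, if_pos h.symm]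
    simp only [edist_comm]
  · rw [if_neg h, if_neg (Ne.symm h)]

theorem edist_le_of_chainLength {x y : Cubing B} {s : ℝ≥0∞}
    (h : ChainLength cubeEDist cubeProj x y s) (b : B.carrier) :
    edist (x.1 b) (y.1 b) ≤ s := by
  have key : ∀ p q : CubeUnion B,
      edist ((cubeProj p).1 b) ((cubeProj q).1 b) ≤ cubeEDist p q := by
    intro p q
    unfold cubeEDist
    split_ifs
    · exact le_iSup (fun b => edist (p.2.1 b) (q.2.1 b)) b
    · exact le_top
  induction h with
  | single p q => exact key p q
  | cons p q y s _ ih =>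
    exact (edist_triangle _ ((cubeProj q).1 b) _).trans (add_le_add (key p q) ih)

theorem quotientEDist_le_one {x y : Cubing B} (h : ShareCube B x.1 y.1) :
    quotientEDist cubeEDist cubeProj x y ≤ 1 := by
  obtain ⟨Q, hQ, hx, hy⟩ := h
  let R : Cube B := ⟨Q, hQ, hQ.subset_component hx x.2⟩
  let p : CubeUnion B := ⟨R, x.1, hx⟩
  let q : CubeUnion B := ⟨R, y.1, hy⟩
  have hc : ChainLength cubeEDist cubeProj x y (cubeEDist p q) := .single p q
  refine (sInf_le hc).trans ?_
  rw [cubeEDist, if_pos rfl]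
  refine iSup_le fun b => ?_
  obtain ⟨U, A, -, -, rfl, -⟩ := hQ
  have h1 := hx.1 b
  have h2 := hy.1 b
  change edist (x.1 b) (y.1 b) ≤ 1
  rw [edist_dist, Real.dist_eq]
  refine ENNReal.ofReal_le_one.2 (abs_sub_le_iff.2 ⟨?_, ?_⟩) <;> linarith [h1.1, h1.2, h2.1, h2.2]

theorem vertex_mem_component : vertex B B.carrier ∈ component B := by
  have h0 : vertex B B.carrier ∈ face B B.carrier ∅ := by
    refine ⟨fun b => ?_, fun _ _ => rfl⟩
    simp [vertex]
  refine .single ⟨_, ⟨B.carrier, ∅, B.isStarSelection, Set.finite_empty, rfl, ?_⟩, h0, h0⟩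
  intro V hV h
  have hb : ∀ b ∈ B.carrier, b ∈ V := by
    intro b hb
    have := h.2 ⟨b, hb⟩ (by simp)
    by_contra hbV
    simp [vertex, hb, hbV] at this
  have : V = B.carrier := by
    refine Set.Subset.antisymm (fun a ha => ?_) hb
    by_contra haB
    rcases B.isStarSelection a with h | h
    · exact haB h.1
    · rcases hV a with h' | h'
      · exact h'.2 (hb _ h.1)
      · exact h'.2 ha
  rw [this]
  exact B.isCoherent

variable (B) in
/-- The vertex `B`, as a point of the cubing. -/
def basePoint : Cubing B := ⟨vertex B B.carrier, vertex_mem_component⟩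

theorem quotientEDist_basepoint_ne_top {x : B.carrier → ℝ}
    (hx : Relation.TransGen (ShareCube B) (vertex B B.carrier) x) :
    quotientEDist cubeEDist cubeProj (basePoint B) ⟨x, hx⟩ ≠ ⊤ := by
  induction hx with
  | single h =>
    exact ne_top_of_le_ne_top ENNReal.one_ne_top
      (quotientEDist_le_one (x := basePoint B) (y := ⟨_, .single h⟩) h)
  | tail h h' ih =>
    exact ne_top_of_le_ne_top (ENNReal.add_ne_top.2 ⟨ih, ENNReal.one_ne_top⟩)
      ((quotientEDist_triangle _ _ _ ⟨_, h⟩ _).trans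
        (add_le_add le_rfl (quotientEDist_le_one (x := ⟨_, h⟩) (y := ⟨_, .tail h h'⟩) h')))

/-- The quotient distance, as an extended metric. -/
instance : EMetricSpace (Cubing B) where
  edist := quotientEDist cubeEDist cubeProj
  edist_self x := by
    obtain ⟨Q, hQ⟩ := exists_cube x
    let p : CubeUnion B := ⟨Q, x.1, hQ⟩
    have hc : ChainLength cubeEDist cubeProj x x (cubeEDist p p) := .single p p
    refine le_antisymm ((sInf_le hc).trans ?_) zero_le
    simp [cubeEDist]
  edist_comm := quotientEDist_comm cubeEDist_comm cubeProj
  edist_triangle := quotientEDist_triangle cubeEDist cubeProj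
  eq_of_edist_eq_zero {x y} h := by
    refine Subtype.ext (funext fun b => ?_)
    have hb : edist (x.1 b) (y.1 b) ≤ quotientEDist cubeEDist cubeProj x y :=
      le_sInf fun s hs => edist_le_of_chainLength hs b
    exact edist_le_zero.1 (hb.trans (le_of_eq h))

/-- The unit piecewise-`ℓ^∞` cubing: the cubing with the quotient metric, which takes finite
values only. -/
instance : MetricSpace (Cubing B) :=
  EMetricSpace.toMetricSpace fun x y =>
    ne_top_of_le_ne_top
      (ENNReal.add_ne_top.2
        ⟨(edist_comm x (basePoint B)).trans_ne (quotientEDist_basepoint_ne_top x.2),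
          quotientEDist_basepoint_ne_top y.2⟩)
      (edist_triangle x (basePoint B) y)

end PocSet

end

/-! A point of the cubing is recorded by its levels: the degree in `[0,1]` to which it selects each
element. Finitely many cubes leave only finitely many active elements, those whose level varies, so
a point becomes a function `φ` on a finite poset `S` with involution, subject to `φ a + φ (star a) =
1` and `φ a = 0 ∨ φ b = 1` for `a < b`.

The metric is governed by `depth φ a`, the maximal sum of `φ` along a chain with top `a`. Truncating
the depth at `1` gives back `φ`. Depths are 1-Lipschitz in each cube, hence for the quotient metric
(`edist_depth_le`). Conversely, `min 1 (depth x a - r) ≤ y a` for all `a` implies `dist x y ≤ r`: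
projecting `y` to the growing balls around `x` traces a path of length at most `r`
(`exists_levels_eq`). So balls are boxes, cut out by lower bounds on the levels.

To extend `f` along `i`, take for each `e` the intersection of the balls around `f j` of radius
`dist (i j) e`. It is again a box: the lower bounds for `a` and `star a` are compatible by
`depth_add_depth_star_le`. Let `F e` be the projection (`gate`) of the base vertex to this box. The
box moves by at most `dist e e'` with `e`, and the projection moves no faster
(`IsBox.depth_gate_sub_le`), so `F` is non-expansive. At `e = i j` the box is the single point `f
j`. -/

noncomputable section

namespace PocSet

/-! ### Chain depths on a finite poset with involution -/

section Depth

/-- The largest sum of values of `φ` along a chain with top element `a`. -/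
def depth {S : Type*} [PartialOrder S] [Finite S] (φ : S → ℝ) (a : S) : ℝ :=
  φ a + ⨆ b : {b // b < a}, depth φ b
termination_by wellFounded_lt.wrap a
decreasing_by exact b.2

variable {S : Type*} [PartialOrder S] [Finite S]

theorem add_depth_le (φ : S → ℝ) {a b : S} (h : b < a) : φ a + depth φ b ≤ depth φ a := by
  rw [depth.eq_1 φ a]
  exact add_le_add le_rfl
    (le_ciSup (f := fun b : {b // b < a} => depth φ b) (Set.finite_range _).bddAbove ⟨b, h⟩)

theorem depth_nonneg {φ : S → ℝ} (hφ : ∀ a, 0 ≤ φ a) (a : S) : 0 ≤ depth φ a := by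
  induction a using WellFoundedLT.induction with
  | _ a ih =>
    rw [depth.eq_1]
    exact add_nonneg (hφ a) (Real.iSup_nonneg fun b => ih b b.2)

theorem le_depth {φ : S → ℝ} (hφ : ∀ a, 0 ≤ φ a) (a : S) : φ a ≤ depth φ a := by
  rw [depth.eq_1]
  exact le_add_of_nonneg_right (Real.iSup_nonneg fun b => depth_nonneg hφ b)

variable [InvolutiveStar S]

/-- The points of the cube complex dual to `S`, as functions recording to which degree an element
is selected. -/
structure IsPoint (φ : S → ℝ) : Prop where
  nonneg : ∀ a, 0 ≤ φ a
  add_star : ∀ a, φ a + φ (star a) = 1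
  eq_zero_or : ∀ a b, a < b → φ a = 0 ∨ φ b = 1

namespace IsPoint

variable {φ ψ : S → ℝ}

omit [Finite S] in
theorem le_one (hφ : IsPoint φ) (a : S) : φ a ≤ 1 := by
  linarith [hφ.add_star a, hφ.nonneg (star a)]

theorem depth_eq_zero (hφ : IsPoint φ) {a : S} (ha : φ a = 0) : depth φ a = 0 := by
  induction a using WellFoundedLT.induction with
  | _ a ih =>
    have h : ∀ b : {b // b < a}, depth φ b = 0 := fun b =>
      ih b b.2 ((hφ.eq_zero_or b a b.2).resolve_right (by rw [ha]; exact zero_ne_one))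
    rw [depth.eq_1, ha]
    simp [h]

theorem pos_of_depth_pos (hφ : IsPoint φ) {a : S} (ha : 0 < depth φ a) : 0 < φ a :=
  (hφ.nonneg a).lt_of_ne fun h => ha.ne' (hφ.depth_eq_zero h.symm)

/-- Positive depth at `a` forces `φ a > 0`, so everything above `a` has the full value `1`. This
growth by whole units is the monotonicity required of a box. -/
theorem depth_add_one_le (hφ : IsPoint φ) {a b : S} (hab : a < b) (ha : 0 < depth φ a) :
    depth φ a + 1 ≤ depth φ b := by
  have h := add_depth_le φ hab
  have := (hφ.eq_zero_or a b hab).resolve_left (hφ.pos_of_depth_pos ha).ne'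
  linarith

/-- In a chain of positive values only the bottom one can be fractional. Hence a depth is a single
value or an exact unit step above another positive depth, which allows induction down the chain. -/
theorem depth_cases (hφ : IsPoint φ) (a : S) :
    depth φ a = φ a ∨
      ∃ b < a, 0 < depth φ b ∧ φ a = 1 ∧ depth φ a = depth φ b + 1 := by
  have he := depth.eq_1 φ a
  rcases isEmpty_or_nonempty {b // b < a} with h | h
  · left
    -- At a minimal element the supremum is empty and takes the default value `0`.
    rw [he, Real.iSup_of_isEmpty, add_zero]
  · obtain ⟨b, hb⟩ := exists_eq_ciSup_of_finite (f := fun b : {b // b < a} => depth φ b)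
    rw [← hb] at he
    rcases (depth_nonneg hφ.nonneg (b : S)).eq_or_lt with h0 | h0
    · left
      rw [he, ← h0, add_zero]
    · have h1 := (hφ.eq_zero_or b a b.2).resolve_left (hφ.pos_of_depth_pos h0).ne'
      exact .inr ⟨b, b.2, h0, h1, by rw [he, h1, add_comm]⟩

theorem depth_of_lt_one (hφ : IsPoint φ) {a : S} (ha : φ a < 1) : depth φ a = φ a :=
  (hφ.depth_cases a).resolve_right fun ⟨_, _, _, h, _⟩ => ha.ne h

theorem min_one_depth (hφ : IsPoint φ) (a : S) : min 1 (depth φ a) = φ a := by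
  rcases hφ.depth_cases a with h | ⟨b, -, h0, h1, h2⟩
  · rw [h, min_eq_right (hφ.le_one a)]
  · rw [h1, min_eq_left (by linarith)]

/-- The depth is `1`-Lipschitz within a cube. -/
theorem depth_le_of_share (hφ : IsPoint φ) (hψ : IsPoint ψ)
    (h : ∀ a b, a < b → (φ a = 0 ∧ ψ a = 0) ∨ (φ b = 1 ∧ ψ b = 1)) {δ : ℝ}
    (hδ : ∀ a, φ a ≤ ψ a + δ) (a : S) : depth φ a ≤ depth ψ a + δ := by
  induction a using WellFoundedLT.induction with
  | _ a ih =>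
    rcases hφ.depth_cases a with h' | ⟨b, hb, h0, h1, h2⟩
    · linarith [hδ a, le_depth hψ.nonneg a]
    -- The unit step into `a` is available to `ψ` too, because `φ b > 0` forces `ψ a = 1`.
    · have := ((h b a hb).resolve_left fun h => (hφ.pos_of_depth_pos h0).ne' h.1).2
      linarith [ih b hb, add_depth_le ψ hb]

/-- The bottom element of a chain that realizes the depth of `a`. -/
theorem exists_chain_bot (hS : ∀ a b : S, a < b → star b < star a) (hφ : IsPoint φ) {a : S}
    (ha : 0 < φ a) :
    ∃ (c : S) (n : ℕ), 0 < φ c ∧ depth φ a = φ c + n ∧ (n = 0 ∧ c = a ∨ 1 ≤ n ∧ c < a) ∧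
      ∀ Λ : S → ℝ, (∀ a b, a < b → 0 < Λ a → Λ a + 1 ≤ Λ b) →
        (0 < Λ c → Λ c + n ≤ Λ a) ∧ (0 < Λ (star a) → Λ (star a) + n ≤ Λ (star c)) := by
  induction a using WellFoundedLT.induction with
  | _ a ih =>
    rcases hφ.depth_cases a with h | ⟨b, hb, h0, h1, h2⟩
    · exact ⟨a, 0, ha, by simp [h], .inl ⟨rfl, rfl⟩, fun Λ _ => by simp⟩
    · obtain ⟨c, n, hc, hd, hcb, H⟩ := ih b hb (hφ.pos_of_depth_pos h0)
      have hca : c < a := by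
        rcases hcb with ⟨-, rfl⟩ | ⟨-, h⟩
        · exact hb
        · exact h.trans hb
      refine ⟨c, n + 1, hc, by push_cast; linarith, .inr ⟨by omega, hca⟩, fun Λ hΛ => ?_⟩
      obtain ⟨H1, H2⟩ := H Λ hΛ
      have hn : (0 : ℝ) ≤ n := n.cast_nonneg
      push_cast
      refine ⟨fun h => ?_, fun h => ?_⟩
      · have := H1 h
        linarith [hΛ b a hb (by linarith)]
      · have := hΛ _ _ (hS b a hb) h
        linarith [H2 (by linarith)]

/-- Depths of complementary elements at two points bound the distance of these points. -/
theorem depth_add_depth_star_le (hS : ∀ a b : S, a < b → star b < star a) (hφ : IsPoint φ)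
    (hψ : IsPoint ψ) {δ : ℝ} (hδ : ∀ a, depth φ a ≤ depth ψ a + δ) {a : S}
    (ha : 0 < depth φ a) (ha' : 0 < depth ψ (star a)) :
    depth φ a + depth ψ (star a) ≤ 1 + δ := by
  obtain ⟨c, n, hc, hd, -, H⟩ := hψ.exists_chain_bot hS (hψ.pos_of_depth_pos ha')
  -- Complementing the chain from `c` up to `star a` gives `n` unit steps from `a` up to `star c`,
  -- where the depth of `ψ` is only `1 - ψ c`.
  have h1 := (H (depth φ) fun a b => hφ.depth_add_one_le).2 (by rwa [star_star])
  rw [star_star] at h1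
  have h2 := hψ.add_star c
  have h3 := hψ.depth_of_lt_one (a := star c) (by linarith)
  linarith [hδ (star c)]

end IsPoint

/-! ### Boxes and projections to them -/

/-- Functions whose truncations are the lower bounds of the coordinates on an intersection of
balls. -/
structure IsBox (Λ : S → ℝ) : Prop where
  nonneg : ∀ a, 0 ≤ Λ a
  add_one_le : ∀ a b, a < b → 0 < Λ a → Λ a + 1 ≤ Λ b
  add_star_le : ∀ a, 0 < Λ a → 0 < Λ (star a) → Λ a + Λ (star a) ≤ 1

/-- The box in question is the ball of radius `t` around `φ`. -/
theorem IsPoint.isBox_depth_sub (hS : ∀ a b : S, a < b → star b < star a) {φ : S → ℝ}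
    (hφ : IsPoint φ) {t : ℝ} (ht : 0 ≤ t) : IsBox fun a => max 0 (depth φ a - t) := by
  refine ⟨fun a => le_max_left _ _, fun a b hab ha => ?_, fun a ha ha' => ?_⟩
  · have ha : 0 < depth φ a - t := (lt_max_iff.1 ha).resolve_left (lt_irrefl _)
    have := hφ.depth_add_one_le hab (by linarith)
    rw [max_eq_right ha.le]
    exact le_max_of_le_right (by linarith)
  · have ha : 0 < depth φ a - t := (lt_max_iff.1 ha).resolve_left (lt_irrefl _)
    have ha' : 0 < depth φ (star a) - t := (lt_max_iff.1 ha').resolve_left (lt_irrefl _)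
    have := hφ.depth_add_depth_star_le hS hφ (δ := 0) (by simp) (a := a) (by linarith)
      (by linarith)
    rw [max_eq_right ha.le, max_eq_right ha'.le]
    linarith

omit [Finite S] in
-- The lower bound at `a` does not exceed the upper bound there, which is one minus the lower bound
-- at `star a`.
theorem IsBox.min_add_min_le {Λ : S → ℝ} (hΛ : IsBox Λ) (a : S) :
    min 1 (Λ a) + min 1 (Λ (star a)) ≤ 1 := by
  have h1 := min_le_left 1 (Λ a)
  have h2 := min_le_left 1 (Λ (star a))
  have h3 := min_le_right 1 (Λ a)
  have h4 := min_le_right 1 (Λ (star a))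
  rcases (hΛ.nonneg a).eq_or_lt with h | h
  · linarith
  rcases (hΛ.nonneg (star a)).eq_or_lt with h' | h'
  · linarith
  linarith [hΛ.add_star_le a h h']

omit [PartialOrder S] [Finite S] in
/-- The projection of the point `ψ` to the box with lower bounds `Λ`. -/
def gate (Λ ψ : S → ℝ) (a : S) : ℝ := max (min 1 (Λ a)) (min (ψ a) (1 - min 1 (Λ (star a))))

omit [Finite S] in
theorem IsBox.gate_add_star {Λ ψ : S → ℝ} (hΛ : IsBox Λ) (hψ : IsPoint ψ) (a : S) :
    gate Λ ψ a + gate Λ ψ (star a) = 1 := by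
  have h1 := hΛ.min_add_min_le a
  have h2 := hψ.add_star a
  unfold gate
  rw [star_star]
  generalize min 1 (Λ a) = p at *
  generalize min 1 (Λ (star a)) = q at *
  grind

omit [Finite S] in
-- Let `a < b`. If `Λ a > 0`, the box forces the value `1` at `b`; if `Λ (star b) > 0`, it forces
-- `0` at `a`. Otherwise the projection does not raise `ψ a` or lower `ψ b`, and the alternative is
-- inherited from `ψ`.
theorem IsBox.isPoint_gate (hS : ∀ a b : S, a < b → star b < star a) {Λ ψ : S → ℝ}
    (hΛ : IsBox Λ) (hψ : IsPoint ψ) : IsPoint (gate Λ ψ) := by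
  refine ⟨fun a => ?_, hΛ.gate_add_star hψ, fun a b hab => ?_⟩
  · exact le_max_of_le_left (le_min zero_le_one (hΛ.nonneg a))
  · have h1 := hΛ.nonneg a
    have h2 := hΛ.add_one_le a b hab
    have h3 := hΛ.nonneg (star b)
    have h4 := hΛ.add_one_le _ _ (hS a b hab)
    have h5 := hΛ.nonneg (star a)
    have h6 := hψ.eq_zero_or a b hab
    have h7 := hψ.nonneg a
    have h8 := hψ.le_one b
    have h9 := hΛ.min_add_min_le b
    unfold gate
    grind

theorem gate_depth {φ ψ : S → ℝ} (hφ : IsPoint φ) {Λ : S → ℝ} (hΛ : ∀ a, Λ a = depth φ a) :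
    gate Λ ψ = φ := by
  funext a
  have := hφ.add_star a
  rw [gate, hΛ, hΛ, hφ.min_one_depth, hφ.min_one_depth, ← this, add_sub_cancel_right]
  exact max_eq_left (min_le_right _ _)

omit [Finite S] in
theorem gate_eq_of_le {Λ ψ : S → ℝ} (hψ : IsPoint ψ) (h : ∀ a, min 1 (Λ a) ≤ ψ a) :
    gate Λ ψ = ψ := by
  funext a
  have h' : ψ a ≤ 1 - min 1 (Λ (star a)) := by linarith [hψ.add_star a, h (star a)]
  rw [gate, min_eq_left h', max_eq_right (h a)]

/-- Projections to nearby boxes are close to each other. -/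
theorem IsBox.depth_gate_sub_le (hS : ∀ a b : S, a < b → star b < star a) {Λ Λ' ψ : S → ℝ}
    (hΛ : IsBox Λ) (hΛ' : IsBox Λ') (hψ : IsPoint ψ) {ε : ℝ} (hε : ∀ a, Λ a ≤ Λ' a + ε)
    (hε' : ∀ a, Λ' a ≤ Λ a + ε) (a : S) :
    min 1 (depth (gate Λ ψ) a - ε) ≤ gate Λ' ψ a := by
  have hφ := hΛ.isPoint_gate hS hψ
  have hφ' := hΛ'.isPoint_gate hS hψ
  have hε0 : 0 ≤ ε := by linarith [hε a, hε' a]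
  rcases (hφ.nonneg a).eq_or_lt with h0 | h0
  · rw [hφ.depth_eq_zero h0.symm]
    exact (min_le_right _ _).trans (by linarith [hφ'.nonneg a])
  obtain ⟨c, n, hc, hd, hca, H⟩ := hφ.exists_chain_bot hS h0
  have H1 := (H Λ hΛ.add_one_le).1
  have H2 := (H Λ' hΛ'.add_one_le).2
  rw [hd]
  -- For a trivial chain the claim is that clamping a number to an interval is 1-Lipschitz in the
  -- endpoints.
  rcases hca with ⟨rfl, rfl⟩ | ⟨hn, hca⟩
  · have h1 : min 1 (Λ c) ≤ min 1 (Λ' c) + ε := by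
      have := hε c
      grind
    have h2 : min 1 (Λ' (star c)) ≤ min 1 (Λ (star c)) + ε := by
      have := hε' (star c)
      grind
    refine (min_le_right _ _).trans ?_
    simp only [gate, Nat.cast_zero, add_zero]
    generalize min 1 (Λ c) = p at *
    generalize min 1 (Λ' c) = p' at *
    generalize min 1 (Λ (star c)) = q at *
    generalize min 1 (Λ' (star c)) = q' at *
    clear H H1 H2 hd hc h0
    grind
  · have hn : (1 : ℝ) ≤ n := by exact_mod_cast hn
    -- If the value at `c` is its lower bound, that bound grows by `n` up to `a`. If not, `ψ c > 0`
    -- gives `ψ a = 1`, and only the upper bound of the second box at `a` matters; the complementary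
    -- chain from `star a` to `star c` shows it to be large.
    rcases max_choice (min 1 (Λ c)) (min (ψ c) (1 - min 1 (Λ (star c)))) with hL | hL
    · have hL : gate Λ ψ c = min 1 (Λ c) := hL
      rw [hL] at hc ⊢
      have := H1 (lt_min_iff.1 hc).2
      have h' : min 1 (Λ c) ≤ Λ c := min_le_right _ _
      exact (min_le_min le_rfl (by linarith [hε a])).trans (le_max_left _ _)
    · have hL : gate Λ ψ c = min (ψ c) (1 - min 1 (Λ (star c))) := hL
      rw [hL] at hc ⊢
      obtain ⟨hc1, hc2⟩ := lt_min_iff.1 hc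
      have ha : ψ a = 1 := (hψ.eq_zero_or c a hca).resolve_left hc1.ne'
      have hq : min 1 (Λ (star c)) = Λ (star c) :=
        min_eq_right (le_of_not_gt fun h => by rw [min_eq_left h.le] at hc2; linarith)
      refine le_trans ?_ (le_max_right _ _)
      rw [ha, hq]
      refine le_min (min_le_left _ _) ?_
      rcases (hΛ'.nonneg (star a)).eq_or_lt with h | h
      · rw [← h, min_eq_right zero_le_one, sub_zero]
        exact min_le_left _ _
      · have h1 := H2 h
        have h2 : min 1 (Λ' (star a)) ≤ Λ' (star a) := min_le_right _ _
        have h3 := min_le_right (ψ c) (1 - Λ (star c))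
        exact (min_le_right _ _).trans (by linarith [hε' (star c)])

/-- Two points of a geodesic lie in a common cube if no depth falls between their parameters. -/
theorem share_gate_depth_sub (hS : ∀ a b : S, a < b → star b < star a) {φ ψ : S → ℝ}
    (hφ : IsPoint φ) (hψ : IsPoint ψ) {t t' : ℝ} (ht : 0 ≤ t) (htt : t ≤ t')
    (h : ∀ a, t < depth φ a → t' ≤ depth φ a) (a b : S) (hab : a < b) :
    (gate (fun a => max 0 (depth φ a - t)) ψ a = 0 ∧
        gate (fun a => max 0 (depth φ a - t')) ψ a = 0) ∨
      (gate (fun a => max 0 (depth φ a - t)) ψ b = 1 ∧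
        gate (fun a => max 0 (depth φ a - t')) ψ b = 1) := by
  have hw := (hφ.isBox_depth_sub hS ht).isPoint_gate hS hψ
  have hw' := (hφ.isBox_depth_sub hS (ht.trans htt)).isPoint_gate hS hψ
  set w := gate (fun a => max 0 (depth φ a - t)) ψ with hwd
  set w' := gate (fun a => max 0 (depth φ a - t')) ψ with hwd'
  -- Suppose `w' b < 1`. Then `w b = 1`, so `depth φ (star b) ≤ t` and the second box does not bound
  -- `b` from above. Hence `ψ b < 1` and `ψ a = 0`, so `w a > 0` comes from `depth φ a > t`. By
  -- hypothesis this depth is at least `t'`, and the unit step to `b` gives `w' b = 1`.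
  have key : ∀ a b, a < b → 0 < w a → w' b = 1 := by
    intro a b hab ha
    refine le_antisymm (hw'.le_one b) (le_of_not_gt fun hb => ?_)
    have hb1 : w b = 1 := (hw.eq_zero_or a b hab).resolve_left ha.ne'
    have hb2 : w (star b) ≤ 0 := by linarith [hw.add_star b]
    have hb3 : depth φ (star b) ≤ t := by
      by_contra! hlt
      have : 0 < w (star b) := lt_max_of_lt_left (lt_min one_pos (lt_max_of_lt_right (by linarith)))
      linarith
    have hb4 : max 0 (depth φ (star b) - t') = 0 := max_eq_left (by linarith)
    have hb5 : depth φ b - t' < 1 := by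
      by_contra! hle
      have : 1 ≤ w' b := le_max_of_le_left (le_min le_rfl (le_max_of_le_right hle))
      linarith
    have hb6 : ψ b < 1 := by
      have : min (ψ b) (1 - min 1 (max 0 (depth φ (star b) - t'))) ≤ w' b := le_max_right _ _
      rw [hb4, min_eq_right zero_le_one, sub_zero, min_eq_left (hψ.le_one b)] at this
      linarith
    have ha0 : ψ a = 0 := (hψ.eq_zero_or a b hab).resolve_right hb6.ne
    have ha1 : t < depth φ a := by
      rcases lt_max_iff.1 ha with h' | h'
      · rcases lt_max_iff.1 (lt_min_iff.1 h').2 with h'' | h''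
        · exact (lt_irrefl _ h'').elim
        · linarith
      · exact absurd (lt_min_iff.1 h').1 ha0.not_gt
    linarith [h a ha1, hφ.depth_add_one_le hab (ht.trans_lt ha1)]
  rcases (hw.nonneg a).eq_or_lt with h0 | h0
  · rcases (hw'.nonneg a).eq_or_lt with h1 | h1
    · exact .inl ⟨h0.symm, h1.symm⟩
    · right
      refine ⟨?_, (hw'.eq_zero_or a b hab).resolve_left h1.ne'⟩
      by_contra hne
      -- Here `key` is applied to the complementary pair `star b < star a`.
      have h2 : 0 < w (star b) := by
        linarith [hw.add_star b, (hw.le_one b).lt_of_ne hne]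
      linarith [key _ _ (hS a b hab) h2, hw'.add_star a]
  · exact .inr ⟨(hw.eq_zero_or a b hab).resolve_left h0.ne', key a b hab h0⟩

end Depth

/-! ### Cubes in terms of levels -/

section Cubing

variable {P : Type*} [PocSet P] {B : Ultra P}

theorem IsStarSelection.star_mem_iff {U : Set P} (hU : IsStarSelection U) {a : P} :
    star a ∈ U ↔ a ∉ U := by
  rcases hU a with h | h
  · exact iff_of_false h.2 (not_not.2 h.1)
  · exact iff_of_true h.1 h.2

theorem Ultra.star_mem_iff (B : Ultra P) {a : P} : star a ∈ B.carrier ↔ a ∉ B.carrier :=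
  B.isStarSelection.star_mem_iff

theorem star_lt_star_of_lt {a b : P} (h : a < b) : star b < star a :=
  (star_le_star_of_le a b h.le).lt_of_ne fun he => h.ne (star_injective he).symm

open Classical in
/-- The degree to which the point `x` of the cube `[0,1]^B` selects the element `a`. -/
def level (x : B.carrier → ℝ) (a : P) : ℝ :=
  if h : a ∈ B.carrier then 1 - x ⟨a, h⟩ else x ⟨star a, B.star_mem_iff.2 h⟩

theorem level_of_mem (x : B.carrier → ℝ) {a : P} (h : a ∈ B.carrier) :
    level x a = 1 - x ⟨a, h⟩ := dif_pos h

theorem level_coe (x : B.carrier → ℝ) (b : B.carrier) : level x b = 1 - x b :=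
  level_of_mem x b.2

theorem level_star (x : B.carrier → ℝ) (a : P) : level x (star a) = 1 - level x a := by
  by_cases h : a ∈ B.carrier
  · have h' : star a ∉ B.carrier := fun h' => B.star_mem_iff.1 h' h
    simp [level, h, h']
  · have h' : star a ∈ B.carrier := B.star_mem_iff.2 h
    simp [level, h, h']

/-- A property of levels that is invariant under complementation may be checked on `B`. -/
theorem forall_of_forall_mem (B : Ultra P) {p : P → Prop} (hp : ∀ b : B.carrier, p b)
    (hstar : ∀ b : B.carrier, p (star b)) (a : P) : p a := by
  by_cases h : a ∈ B.carrier
  · exact hp ⟨a, h⟩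
  · have := hstar ⟨star a, B.star_mem_iff.2 h⟩
    rwa [star_star] at this

theorem exists_selection (B : Ultra P) (p : B.carrier → Prop) :
    ∃ V : Set P, IsStarSelection V ∧ ∀ b : B.carrier, (b : P) ∈ V ↔ p b := by
  classical
  refine ⟨{a | if h : a ∈ B.carrier then p ⟨a, h⟩ else ¬ p ⟨star a, B.star_mem_iff.2 h⟩},
    fun a => ?_, fun b => by simp⟩
  by_cases h : a ∈ B.carrier
  · have h' : star a ∉ B.carrier := fun h' => B.star_mem_iff.1 h' h
    simp only [Set.mem_ofPred_eq, h, h', dif_pos, dif_neg, star_star, not_false_eq_true]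
    by_cases hp : p ⟨a, h⟩ <;> simp [Xor, hp]
  · have h' : star a ∈ B.carrier := B.star_mem_iff.2 h
    simp only [Set.mem_ofPred_eq, h, h', dif_pos, dif_neg, not_false_eq_true]
    by_cases hp : p ⟨star a, h'⟩ <;> simp [Xor, hp]

theorem vertex_of_mem {V : Set P} {b : B.carrier} (h : (b : P) ∈ V) : vertex B V b = 0 :=
  if_pos h

theorem vertex_of_notMem {V : Set P} {b : B.carrier} (h : (b : P) ∉ V) : vertex B V b = 1 :=
  if_neg h

theorem vertex_eq_iff {U V : Set P} {b : B.carrier} :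
    vertex B V b = vertex B U b ↔ ((b : P) ∈ V ↔ (b : P) ∈ U) := by
  by_cases hU : (b : P) ∈ U <;> by_cases hV : (b : P) ∈ V <;> simp [vertex, hU, hV]

/-- The free coordinates of a cube are pairwise transverse. -/
theorem IsCube.share {Q : Set (B.carrier → ℝ)} (hQ : IsCube B Q) {x y : B.carrier → ℝ}
    (hx : x ∈ Q) (hy : y ∈ Q) {a c : P} (hac : a < c) :
    (level x a = 0 ∧ level y a = 0) ∨ (level x c = 1 ∧ level y c = 1) := by
  obtain ⟨U, A, hU, -, rfl, hV⟩ := hQ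
  by_contra hcon
  rw [not_or] at hcon
  -- If both alternatives fail, the cube has a vertex selecting both `a` and `star c`: free
  -- coordinates are set that way and fixed ones already allow it. This vertex is incoherent since
  -- `a ≤ c`.
  obtain ⟨V, hVs, hVp⟩ := exists_selection B
    fun b => (b ∈ A ∧ ((b : P) = a ∨ (b : P) = star c)) ∨ (b ∉ A ∧ (b : P) ∈ U)
  have hVQ : vertex B V ∈ face B U A := by
    refine ⟨fun b => ?_, fun b hb => vertex_eq_iff.2 ?_⟩
    · by_cases h : (b : P) ∈ V <;> simp [vertex, h]
    · simp [hVp, hb]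
  have key : ∀ p : P, (p = a ∨ p = star c) → (star p ≠ a ∧ star p ≠ star c) →
      ¬ (level x p = 0 ∧ level y p = 0) → p ∈ V := by
    intro p hp hp' hl
    by_cases hpB : p ∈ B.carrier
    · refine (hVp ⟨p, hpB⟩).2 ?_
      by_cases hA : (⟨p, hpB⟩ : B.carrier) ∈ A
      · exact .inl ⟨hA, hp⟩
      · refine .inr ⟨hA, ?_⟩
        by_contra hpU
        refine hl ⟨?_, ?_⟩
        · rw [level_of_mem _ hpB, hx.2 _ hA, vertex_of_notMem hpU, sub_self]
        · rw [level_of_mem _ hpB, hy.2 _ hA, vertex_of_notMem hpU, sub_self]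
    · have hpB' := B.star_mem_iff.2 hpB
      by_contra hpV
      rcases (hVp ⟨star p, hpB'⟩).1 (hVs.star_mem_iff.2 hpV) with ⟨-, h⟩ | ⟨hA, h⟩
      · exact h.elim hp'.1 hp'.2
      · refine hl ⟨?_, ?_⟩
        · rw [← sub_eq_self (a := (1 : ℝ)), ← level_star, level_of_mem _ hpB', hx.2 _ hA,
            vertex_of_mem h, sub_zero]
        · rw [← sub_eq_self (a := (1 : ℝ)), ← level_star, level_of_mem _ hpB', hy.2 _ hA,
            vertex_of_mem h, sub_zero]
  have hfix : ∀ p : P, star p ≠ p := fun p hp => by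
    have := B.star_mem_iff (a := p)
    rw [hp] at this
    tauto
  refine hV V hVs hVQ a (key a (.inl rfl) ⟨hfix a, fun h => hac.ne (star_injective h)⟩ hcon.1)
    (star c) (key _ (.inr rfl) ⟨?_, hfix _⟩ ?_) ?_
  · rw [star_star]
    exact hac.ne'
  · rw [level_star, level_star, sub_eq_zero, sub_eq_zero]
    exact fun h => hcon.2 ⟨h.1.symm, h.2.symm⟩
  · rw [star_star]
    exact hac.le

/-- Converse to `IsCube.share`: the cube is the face whose free coordinates are those not at a
common endpoint `0` or `1`. An element of level `0` at both points is in no vertex of it, so an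
incoherent pair is excluded. -/
theorem shareCube_of_level {x y : B.carrier → ℝ} (hx : ∀ b, x b ∈ Set.Icc (0 : ℝ) 1)
    (hy : ∀ b, y b ∈ Set.Icc (0 : ℝ) 1)
    (h : ∀ a c : P, a < c → (level x a = 0 ∧ level y a = 0) ∨ (level x c = 1 ∧ level y c = 1))
    (hfin : {b | ¬ (x b = 0 ∧ y b = 0) ∧ ¬ (x b = 1 ∧ y b = 1)}.Finite) : ShareCube B x y := by
  obtain ⟨U, hU, hUp⟩ := exists_selection B fun b => x b = 0 ∧ y b = 0
  have hmem : ∀ b, b ∉ {b | ¬ (x b = 0 ∧ y b = 0) ∧ ¬ (x b = 1 ∧ y b = 1)} →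
      x b = vertex B U b ∧ y b = vertex B U b := by
    intro b hb
    by_cases hbU : (b : P) ∈ U
    · rw [vertex_of_mem hbU]
      exact (hUp b).1 hbU
    · rw [vertex_of_notMem hbU]
      exact not_not.1 fun h1 => hb ⟨fun h0 => hbU ((hUp b).2 h0), h1⟩
  refine ⟨face B U _, ⟨U, _, hU, hfin, rfl, fun V hV hVQ => ?_⟩, ⟨hx, fun b hb => (hmem b hb).1⟩,
    ⟨hy, fun b hb => (hmem b hb).2⟩⟩
  have key : ∀ p : P, level x p = 0 ∧ level y p = 0 → p ∉ V := by
    refine forall_of_forall_mem B (fun b hb hbV => ?_) (fun b hb hbV => ?_)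
    · rw [level_coe, level_coe, sub_eq_zero, sub_eq_zero] at hb
      have := hVQ.2 b (fun h => h.2 ⟨hb.1.symm, hb.2.symm⟩)
      rw [vertex_of_mem hbV, vertex_of_notMem] at this
      · exact zero_ne_one this
      · rw [hUp, ← hb.1]
        exact fun h => one_ne_zero h.1
    · rw [level_star, level_star, level_coe, level_coe, sub_sub_cancel, sub_sub_cancel] at hb
      have := hVQ.2 b (fun h => h.1 hb)
      rw [vertex_of_notMem (hV.star_mem_iff.1 hbV), vertex_of_mem ((hUp b).2 hb)] at this
      exact one_ne_zero this
  intro a ha c hc hac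
  rcases hac.eq_or_lt with rfl | hlt
  · exact hV.star_mem_iff.1 ha hc
  · rcases h a _ hlt with h | h
    · exact key a h ha
    · rw [level_star, level_star, sub_eq_self, sub_eq_self] at h
      exact key c h hc

theorem level_mem_Icc {x : B.carrier → ℝ} (hx : ∀ b, x b ∈ Set.Icc (0 : ℝ) 1) (a : P) :
    level x a ∈ Set.Icc (0 : ℝ) 1 := by
  refine forall_of_forall_mem B (p := fun a => level x a ∈ Set.Icc (0 : ℝ) 1) (fun b => ?_)
    (fun b => ?_) a
  · rw [level_coe]
    exact ⟨by linarith [(hx b).2], by linarith [(hx b).1]⟩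
  · rw [level_star, level_coe, sub_sub_cancel]
    exact hx b

theorem Cubing.share (x : Cubing B) {a c : P} (hac : a < c) :
    level x.1 a = 0 ∨ level x.1 c = 1 := by
  obtain ⟨Q, hQ⟩ := exists_cube x
  exact (Q.2.1.share hQ hQ hac).imp And.left And.left

theorem Cubing.mem_Icc (x : Cubing B) (b : B.carrier) : x.1 b ∈ Set.Icc (0 : ℝ) 1 := by
  obtain ⟨⟨_, ⟨U, A, hU, hA, rfl, hV⟩, hQ⟩, hx⟩ := exists_cube x
  exact hx.1 b

/-! ### Active elements: reduction to a finite poset -/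

variable (B) in
/-- The elements whose level is not constant on the cubing. -/
def Active (a : P) : Prop := ∃ x : Cubing B, level x.1 a ≠ level (basePoint B).1 a

theorem Active.star {a : P} (h : Active B a) : Active B (star a) := by
  obtain ⟨x, hx⟩ := h
  refine ⟨x, ?_⟩
  rw [level_star, level_star]
  exact fun h => hx (sub_right_injective h)

theorem active_star_iff {a : P} : Active B (star a) ↔ Active B a :=
  ⟨fun h => by simpa using h.star, Active.star⟩

theorem level_eq_of_not_active {a : P} (h : ¬ Active B a) (x : Cubing B) :
    level x.1 a = level (basePoint B).1 a :=
  not_not.1 fun hx => h ⟨x, hx⟩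

theorem basePoint_apply (b : B.carrier) : (basePoint B).1 b = 0 := vertex_of_mem b.2

variable (B) in
/-- The poset with involution of the active elements. -/
abbrev ActiveElem : Type _ := {a : P // Active B a}

instance : InvolutiveStar (ActiveElem B) where
  star a := ⟨star a.1, a.2.star⟩
  star_involutive a := Subtype.ext (star_star a.1)

theorem coe_star_active (a : ActiveElem B) : ((star a : ActiveElem B) : P) = star (a : P) := rfl

theorem star_lt_star_active (a b : ActiveElem B) (h : a < b) : star b < star a :=
  star_lt_star_of_lt (P := P) h

/-- Each cube has finitely many free coordinates, and a coordinate free in no cube of the component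
stays `0` along every path from the base vertex. -/
theorem finite_active [Finite (Cube B)] : Finite (ActiveElem B) := by
  have hfree : ∀ Q : Cube B, ∃ A : Set B.carrier, A.Finite ∧
      ∀ b ∉ A, ∀ x ∈ Q.1, ∀ y ∈ Q.1, x b = y b := by
    rintro ⟨_, ⟨U, A, -, hA, rfl, -⟩, -⟩
    exact ⟨A, hA, fun b hb x hx y hy => (hx.2 b hb).trans (hy.2 b hb).symm⟩
  choose A hA hAQ using hfree
  have key : ∀ x (_ : Relation.TransGen (ShareCube B) (vertex B B.carrier) x) (b : B.carrier),
      b ∉ ⋃ Q, A Q → x b = 0 := by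
    intro x hx b hb
    have hstep : ∀ y z, y ∈ component B → ShareCube B y z → z b = y b := by
      rintro y z hy ⟨Q, hQ, hyQ, hzQ⟩
      exact hAQ ⟨Q, hQ, hQ.subset_component hyQ hy⟩ b (fun h => hb (Set.mem_iUnion_of_mem _ h))
        z hzQ y hyQ
    induction hx with
    | single h => exact (hstep _ _ vertex_mem_component h).trans (vertex_of_mem b.2)
    | tail h h' ih => exact (hstep _ _ h h').trans ih
  have hT : (⋃ Q, A Q).Finite := Set.finite_iUnion hA
  have hT' := hT.image (Subtype.val : B.carrier → P)
  refine Set.Finite.to_subtype (s := {a | Active B a}) ((hT'.union (hT'.image star)).subset ?_)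
  have hb : ∀ b : B.carrier, Active B (b : P) → b ∈ ⋃ Q, A Q := by
    rintro b ⟨x, hx⟩
    by_contra hbT
    rw [level_coe, level_coe, key _ x.2 b hbT, basePoint_apply] at hx
    exact hx rfl
  refine forall_of_forall_mem B (fun b h => .inl ⟨b, hb b h, rfl⟩) (fun b h => .inr ?_)
  exact ⟨b, ⟨b, hb b (active_star_iff.1 h), rfl⟩, rfl⟩

/-- The active levels of a point. -/
def Cubing.levels (x : Cubing B) (a : ActiveElem B) : ℝ := level x.1 (a : P)

theorem Cubing.isPoint_levels (x : Cubing B) : IsPoint x.levels where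
  nonneg a := (level_mem_Icc x.mem_Icc _).1
  add_star a := by
    rw [levels, levels, coe_star_active, level_star, add_sub_cancel]
  eq_zero_or _ _ h := x.share h

open Classical in
/-- The point with given active levels. -/
def ofLevels (φ : ActiveElem B → ℝ) (b : B.carrier) : ℝ :=
  if h : Active B (b : P) then 1 - φ ⟨b, h⟩ else 0

theorem level_ofLevels_of_active {φ : ActiveElem B → ℝ} (hφ : IsPoint φ) (a : ActiveElem B) :
    level (ofLevels φ) a.1 = φ a := by
  obtain ⟨a, ha⟩ := a
  revert a
  refine forall_of_forall_mem B (fun b hb => ?_) (fun b hb => ?_)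
  · rw [level_coe, ofLevels, dif_pos hb, sub_sub_cancel]
  · have hb' := active_star_iff.1 hb
    have := hφ.add_star ⟨b, hb'⟩
    change φ ⟨b, hb'⟩ + φ ⟨star b, hb⟩ = 1 at this
    change level (ofLevels φ) (star (b : P)) = _
    rw [level_star, level_coe, ofLevels, dif_pos hb']
    linarith

theorem level_ofLevels_of_not_active (φ : ActiveElem B → ℝ) {a : P} (ha : ¬ Active B a) :
    level (ofLevels φ) a = level (basePoint B).1 a := by
  refine forall_of_forall_mem B (p := fun a => ¬ Active B a →
    level (ofLevels φ) a = level (basePoint B).1 a) (fun b hb => ?_) (fun b hb => ?_) a ha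
  · rw [level_coe, ofLevels, dif_neg hb, level_coe, basePoint_apply]
  · have hb' := mt active_star_iff.2 hb
    rw [level_star, level_coe, ofLevels, dif_neg hb', level_star, level_coe, basePoint_apply]

theorem level_injective {x y : B.carrier → ℝ} (h : ∀ a, level x a = level y a) : x = y := by
  funext b
  have := h b
  rwa [level_coe, level_coe, sub_right_inj] at this

theorem Cubing.ofLevels_levels (x : Cubing B) : ofLevels x.levels = x.1 := by
  refine level_injective fun a => ?_
  by_cases ha : Active B a
  · exact level_ofLevels_of_active x.isPoint_levels ⟨a, ha⟩
  · rw [level_ofLevels_of_not_active _ ha, level_eq_of_not_active ha x]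

theorem Cubing.levels_injective {x y : Cubing B} (h : x.levels = y.levels) : x = y :=
  Subtype.ext (by rw [← x.ofLevels_levels, h, y.ofLevels_levels])

theorem ofLevels_mem_Icc {φ : ActiveElem B → ℝ} (hφ : IsPoint φ) (b : B.carrier) :
    ofLevels φ b ∈ Set.Icc (0 : ℝ) 1 := by
  unfold ofLevels
  split_ifs with h
  · exact ⟨by linarith [hφ.le_one ⟨b, h⟩], by linarith [hφ.nonneg ⟨b, h⟩]⟩
  · exact ⟨le_rfl, zero_le_one⟩

/-- Above an active element, an inactive one is selected everywhere. -/
theorem level_basePoint_of_active_lt {a c : P} (ha : Active B a) (hc : ¬ Active B c)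
    (hac : a < c) : level (basePoint B).1 c = 1 := by
  obtain ⟨x, hx⟩ := ha
  rcases x.share hac with h | h
  · rcases (basePoint B).share hac with h' | h'
    · exact absurd (h.trans h'.symm) hx
    · exact h'
  · rwa [level_eq_of_not_active hc] at h

/-- Only active pairs need checking: inactive elements have level `1` above an active one and `0`
below, and inactive pairs inherit the alternative from the base vertex. Finiteness of the active
elements keeps the cube finite-dimensional. -/
theorem shareCube_ofLevels [Finite (ActiveElem B)] {φ ψ : ActiveElem B → ℝ} (hφ : IsPoint φ)
    (hψ : IsPoint ψ)
    (h : ∀ a b, a < b → (φ a = 0 ∧ ψ a = 0) ∨ (φ b = 1 ∧ ψ b = 1)) :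
    ShareCube B (ofLevels φ) (ofLevels ψ) := by
  refine shareCube_of_level (ofLevels_mem_Icc hφ) (ofLevels_mem_Icc hψ) (fun a c hac => ?_) ?_
  · by_cases ha : Active B a <;> by_cases hc : Active B c
    · rw [level_ofLevels_of_active hφ ⟨a, ha⟩, level_ofLevels_of_active hψ ⟨a, ha⟩,
        level_ofLevels_of_active hφ ⟨c, hc⟩, level_ofLevels_of_active hψ ⟨c, hc⟩]
      exact h ⟨a, ha⟩ ⟨c, hc⟩ hac
    · right
      rw [level_ofLevels_of_not_active _ hc, level_ofLevels_of_not_active _ hc]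
      exact and_self_iff.2 (level_basePoint_of_active_lt ha hc hac)
    · left
      rw [level_ofLevels_of_not_active _ ha, level_ofLevels_of_not_active _ ha, and_self_iff]
      have := level_basePoint_of_active_lt hc.star (mt active_star_iff.1 ha)
        (star_lt_star_of_lt hac)
      rwa [level_star, sub_eq_self] at this
    · rw [level_ofLevels_of_not_active _ ha, level_ofLevels_of_not_active _ ha,
        level_ofLevels_of_not_active _ hc, level_ofLevels_of_not_active _ hc, and_self_iff,
        and_self_iff]
      exact (basePoint B).share hac
  · have hfin : {a | Active B a}.Finite := Set.finite_coe_iff.1 ‹Finite (ActiveElem B)›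
    refine (hfin.preimage (Subtype.val_injective (p := (· ∈ B.carrier))).injOn).subset ?_
    intro b hb
    by_contra hna
    refine hb.1 ?_
    have hna : ¬ Active B (b : P) := hna
    simp [ofLevels, hna]

/-! ### The quotient metric in terms of depths -/

theorem quotientEDist_le_ofReal {x y : Cubing B} (h : ShareCube B x.1 y.1) {δ : ℝ}
    (hδ : ∀ b, |x.1 b - y.1 b| ≤ δ) :
    quotientEDist cubeEDist cubeProj x y ≤ ENNReal.ofReal δ := by
  obtain ⟨Q, hQ, hx, hy⟩ := h
  let R : Cube B := ⟨Q, hQ, hQ.subset_component hx x.2⟩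
  let p : CubeUnion B := ⟨R, x.1, hx⟩
  let q : CubeUnion B := ⟨R, y.1, hy⟩
  have hc : ChainLength cubeEDist cubeProj x y (cubeEDist p q) := .single p q
  refine (sInf_le hc).trans ?_
  rw [cubeEDist, if_pos rfl]
  refine iSup_le fun b => ?_
  change edist (x.1 b) (y.1 b) ≤ _
  rw [edist_dist, Real.dist_eq]
  exact ENNReal.ofReal_le_ofReal (hδ b)

theorem exists_levels_eq_of_share [Finite (ActiveElem B)] (x : Cubing B) {ψ : ActiveElem B → ℝ}
    (hψ : IsPoint ψ)
    (h : ∀ a b, a < b → (x.levels a = 0 ∧ ψ a = 0) ∨ (x.levels b = 1 ∧ ψ b = 1)) {δ : ℝ}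
    (hδ0 : 0 ≤ δ) (hδ : ∀ a, |x.levels a - ψ a| ≤ δ) :
    ∃ y : Cubing B, y.levels = ψ ∧ edist x y ≤ ENNReal.ofReal δ := by
  have hs := shareCube_ofLevels x.isPoint_levels hψ h
  rw [x.ofLevels_levels] at hs
  let y : Cubing B := ⟨ofLevels ψ, Relation.TransGen.tail x.2 hs⟩
  refine ⟨y, funext fun a => level_ofLevels_of_active hψ a,
    quotientEDist_le_ofReal (y := y) hs fun b => ?_⟩
  change |x.1 b - ofLevels ψ b| ≤ δ
  rw [← x.ofLevels_levels]
  unfold ofLevels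
  split_ifs with hb
  · rw [sub_sub_sub_cancel_left, abs_sub_comm]
    exact hδ _
  · simpa using hδ0

theorem abs_level_sub_le {x y : B.carrier → ℝ} {δ : ℝ} (h : ∀ b, |x b - y b| ≤ δ) (a : P) :
    |level x a - level y a| ≤ δ := by
  refine forall_of_forall_mem B (p := fun a => |level x a - level y a| ≤ δ) (fun b => ?_)
    (fun b => ?_) a
  · rw [level_coe, level_coe, sub_sub_sub_cancel_left, abs_sub_comm]
    exact h b
  · rw [level_star, level_star, level_coe, level_coe, sub_sub_cancel, sub_sub_cancel]
    exact h b

/-- Each finite link of a connecting chain lies in one cube, where `IsPoint.depth_le_of_share`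
applies in both directions; the triangle inequality adds the links. -/
theorem edist_depth_le [Finite (ActiveElem B)] (x y : Cubing B) (a : ActiveElem B) :
    edist (depth x.levels a) (depth y.levels a) ≤ edist x y := by
  have key : ∀ p q : CubeUnion B,
      edist (depth (cubeProj p).levels a) (depth (cubeProj q).levels a) ≤ cubeEDist p q := by
    rintro ⟨Q, x, hx⟩ ⟨R, y, hy⟩
    unfold cubeEDist
    split_ifs with hQR
    swap
    · exact le_top
    obtain rfl : Q = R := hQR
    rcases eq_or_ne (⨆ b, edist (x b) (y b)) ⊤ with htop | htop
    · exact htop.symm ▸ le_top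
    set s := ⨆ b, edist (x b) (y b)
    have hδ : ∀ b, |x b - y b| ≤ s.toReal := fun b => by
      rw [← Real.dist_eq, dist_edist]
      exact ENNReal.toReal_mono htop (le_iSup (fun b => edist (x b) (y b)) b)
    set X : Cubing B := cubeProj ⟨Q, x, hx⟩
    set Y : Cubing B := cubeProj ⟨Q, y, hy⟩
    have hl : ∀ a, |X.levels a - Y.levels a| ≤ s.toReal := fun a => abs_level_sub_le hδ a.1
    have hs : ∀ a b, a < b →
        (X.levels a = 0 ∧ Y.levels a = 0) ∨ (X.levels b = 1 ∧ Y.levels b = 1) :=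
      fun a b hab => Q.2.1.share hx hy hab
    change _ ≤ s
    rw [← ENNReal.ofReal_toReal htop, edist_dist, Real.dist_eq]
    refine ENNReal.ofReal_le_ofReal (abs_sub_le_iff.2 ⟨?_, ?_⟩)
    · have := X.isPoint_levels.depth_le_of_share Y.isPoint_levels hs (δ := s.toReal)
        (fun a => by linarith [(abs_sub_le_iff.1 (hl a)).1]) a
      linarith
    · have := Y.isPoint_levels.depth_le_of_share X.isPoint_levels
        (fun a b hab => (hs a b hab).imp And.symm And.symm) (δ := s.toReal)
        (fun a => by linarith [(abs_sub_le_iff.1 (hl a)).2]) a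
      linarith
  refine le_sInf fun s hs => ?_
  induction hs with
  | single p q => exact key p q
  | cons p q y s _ ih => exact (edist_triangle _ _ _).trans (add_le_add (key p q) ih)

theorem depth_le_depth_add_dist [Finite (ActiveElem B)] (x y : Cubing B) (a : ActiveElem B) :
    depth x.levels a ≤ depth y.levels a + dist x y := by
  have h : dist (depth x.levels a) (depth y.levels a) ≤ dist x y := by
    rw [dist_edist, dist_edist]
    exact ENNReal.toReal_mono (edist_ne_top _ _) (edist_depth_le x y a)
  rw [Real.dist_eq] at h
  linarith [(abs_sub_le_iff.1 h).1]

/-- Points whose levels are close are connected by a short path in the cubing. -/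
theorem exists_levels_eq [Finite (ActiveElem B)] (x : Cubing B) {ψ : ActiveElem B → ℝ}
    (hψ : IsPoint ψ) {r : ℝ} (hr : 0 ≤ r) (h : ∀ a, min 1 (depth x.levels a - r) ≤ ψ a) :
    ∃ y : Cubing B, y.levels = ψ ∧ dist x y ≤ r := by
  -- `w t` is the projection of `ψ` to the ball of radius `t` around `x`. It runs from `x` at `t =
  -- 0` to `ψ` at `t = r`.
  set w : ℝ → ActiveElem B → ℝ := fun t => gate (fun a => max 0 (depth x.levels a - t)) ψ with hw
  have hS := star_lt_star_active (B := B)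
  have hbox : ∀ t, 0 ≤ t → IsBox fun a => max 0 (depth x.levels a - t) :=
    fun t ht => x.isPoint_levels.isBox_depth_sub hS ht
  have hpt : ∀ t, 0 ≤ t → IsPoint (w t) := fun t ht => (hbox t ht).isPoint_gate hS hψ
  have hlip : ∀ t t', 0 ≤ t → 0 ≤ t' → ∀ a, w t a ≤ w t' a + |t - t'| := by
    intro t t' ht ht' a
    have hle : ∀ t t' : ℝ, ∀ a,
        max 0 (depth x.levels a - t) ≤ max 0 (depth x.levels a - t') + |t - t'| := by
      intro t t' a
      refine max_le (add_nonneg (le_max_left _ _) (abs_nonneg _)) ?_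
      linarith [le_max_right 0 (depth x.levels a - t'), neg_abs_le (t - t')]
    have := (hbox t ht).depth_gate_sub_le hS (hbox t' ht') hψ (ε := |t - t'|) (hle t t')
      (fun a => by rw [abs_sub_comm]; exact hle t' t a) a
    have h1 := le_depth (hpt t ht).nonneg a
    have h2 := (hpt t ht).le_one a
    have h3 := abs_nonneg (t - t')
    have h4 : w t a - |t - t'| ≤ min 1 (depth (w t) a - |t - t'|) :=
      le_min (by linarith) (by linarith)
    change min 1 (depth (w t) a - |t - t'|) ≤ w t' a at this
    linarith
  have main : ∀ (n : ℕ) (t t' : ℝ), 0 ≤ t → t ≤ t' →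
      {a | t < depth x.levels a ∧ depth x.levels a < t'}.ncard = n → ∀ y : Cubing B,
        y.levels = w t → ∃ z : Cubing B, z.levels = w t' ∧ edist y z ≤ ENNReal.ofReal (t' - t) := by
    intro n
    induction n using Nat.strong_induction_on with
    | _ n ih =>
      intro t t' ht htt hn y hy
      -- Split the parameter interval at a depth of `x` strictly inside it. When none is left, both
      -- ends lie in a common cube.
      by_cases hc : ∃ c, t < depth x.levels c ∧ depth x.levels c < t'
      · obtain ⟨c, hc1, hc2⟩ := hc
        have h1 : {a | t < depth x.levels a ∧ depth x.levels a < depth x.levels c}.ncard < n := by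
          rw [← hn]
          refine Set.ncard_lt_ncard ⟨fun a ha => ⟨ha.1, ha.2.trans hc2⟩, fun hsub => ?_⟩
          exact lt_irrefl _ (hsub (a := c) ⟨hc1, hc2⟩).2
        have h2 : {a | depth x.levels c < depth x.levels a ∧ depth x.levels a < t'}.ncard < n := by
          rw [← hn]
          refine Set.ncard_lt_ncard ⟨fun a ha => ⟨hc1.trans ha.1, ha.2⟩, fun hsub => ?_⟩
          exact lt_irrefl _ (hsub (a := c) ⟨hc1, hc2⟩).1
        obtain ⟨z, hz, hyz⟩ := ih _ h1 t _ ht hc1.le rfl y hy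
        obtain ⟨z', hz', hzz⟩ := ih _ h2 _ t' (ht.trans hc1.le) hc2.le rfl z hz
        refine ⟨z', hz', (edist_triangle y z z').trans ((add_le_add hyz hzz).trans ?_)⟩
        rw [← ENNReal.ofReal_add (by linarith) (by linarith)]
        exact ENNReal.ofReal_le_ofReal (by linarith)
      · push Not at hc
        refine exists_levels_eq_of_share y (hpt t' (ht.trans htt)) ?_ (sub_nonneg.2 htt) ?_
        · rw [hy]
          exact share_gate_depth_sub hS x.isPoint_levels hψ ht htt hc
        · intro a
          rw [hy, abs_sub_le_iff]
          have h1 := hlip t t' ht (ht.trans htt) a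
          have h2 := hlip t' t (ht.trans htt) ht a
          rw [abs_of_nonneg (sub_nonneg.2 htt)] at h2
          rw [abs_sub_comm, abs_of_nonneg (sub_nonneg.2 htt)] at h1
          exact ⟨by linarith, by linarith⟩
  have h0 : x.levels = w 0 := (gate_depth x.isPoint_levels fun a => by
    rw [sub_zero, max_eq_right (depth_nonneg x.isPoint_levels.nonneg a)]).symm
  have hr' : w r = ψ := gate_eq_of_le hψ fun a => by
    rcases le_total 0 (depth x.levels a - r) with h' | h'
    · rw [max_eq_right h']
      exact h a
    · rw [max_eq_left h', min_eq_right zero_le_one]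
      exact hψ.nonneg a
  obtain ⟨y, hy, hxy⟩ := main _ 0 r le_rfl hr rfl x h0
  refine ⟨y, hy.trans hr', ?_⟩
  rw [sub_zero] at hxy
  rw [dist_edist]
  exact ENNReal.toReal_le_of_le_ofReal hr hxy

theorem exists_levels_eq_of_isPoint [Finite (ActiveElem B)] {ψ : ActiveElem B → ℝ}
    (hψ : IsPoint ψ) : ∃ y : Cubing B, y.levels = ψ := by
  -- A radius above all depths of the base vertex makes the condition of `exists_levels_eq` vacuous.
  obtain ⟨K, hK⟩ := (Set.finite_range (depth (basePoint B).levels)).bddAbove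
  obtain ⟨y, hy, -⟩ := exists_levels_eq (basePoint B) hψ (le_max_left 0 K) fun a =>
    (min_le_right _ _).trans (by
      linarith [hK (Set.mem_range_self a), le_max_right 0 K, hψ.nonneg a])
  exact ⟨y, hy⟩

/-! ### The intersection of balls that prescribes the extension -/

section Extension

variable {A E : Type*} [MetricSpace A] [MetricSpace E]

/-- The lower bounds on the depths of the image of `e` imposed by a non-expansive map `f` that is
to be extended along `i`. -/
def extensionBound [Finite (ActiveElem B)] (i : A → E) (f : A → Cubing B) (e : E)
    (a : ActiveElem B) : ℝ :=
  ⨆ j, max 0 (depth (f j).levels a - dist (i j) e)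

variable [Finite (ActiveElem B)] {i : A → E} {f : A → Cubing B}

theorem le_extensionBound (hi : Isometry i) (hf : LipschitzWith 1 f) (e : E) (a : ActiveElem B)
    (j : A) : depth (f j).levels a - dist (i j) e ≤ extensionBound i f e a := by
  refine (le_max_right _ _).trans
    (le_ciSup (f := fun j => max 0 (depth (f j).levels a - dist (i j) e)) ?_ j)
  refine ⟨depth (f j).levels a + dist (i j) e, ?_⟩
  rintro _ ⟨k, rfl⟩
  refine max_le (add_nonneg (depth_nonneg (f j).isPoint_levels.nonneg a) dist_nonneg) ?_
  have h1 := depth_le_depth_add_dist (f k) (f j) a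
  have h2 := hf.dist_le_mul k j
  have h3 := hi.dist_eq k j
  have h4 := dist_triangle_right (i k) (i j) e
  rw [NNReal.coe_one, one_mul] at h2
  linarith

omit [MetricSpace A] in
theorem extensionBound_nonneg (i : A → E) (f : A → Cubing B) (e : E) (a : ActiveElem B) :
    0 ≤ extensionBound i f e a := Real.iSup_nonneg fun _ => le_max_left _ _

omit [MetricSpace A] in
-- Taking `s` nonnegative disposes of the truncation at `0` and of the default value `0` of the
-- supremum over an empty `A`.
theorem exists_of_lt_extensionBound {e : E} {a : ActiveElem B} {s : ℝ} (hs : 0 ≤ s)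
    (h : s < extensionBound i f e a) : ∃ j, s < depth (f j).levels a - dist (i j) e := by
  by_contra! hcon
  exact h.not_ge (Real.iSup_le (fun j => max_le hs (hcon j)) hs)

theorem extensionBound_le_add_dist (hi : Isometry i) (hf : LipschitzWith 1 f) (e e' : E)
    (a : ActiveElem B) : extensionBound i f e a ≤ extensionBound i f e' a + dist e e' := by
  by_contra! h
  obtain ⟨j, hj⟩ := exists_of_lt_extensionBound
    (add_nonneg (extensionBound_nonneg i f e' a) dist_nonneg) h
  linarith [le_extensionBound hi hf e' a j, dist_triangle_right (i j) e' e, dist_comm e e',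
    dist_triangle (i j) e e']

theorem isBox_extensionBound (hi : Isometry i) (hf : LipschitzWith 1 f) (e : E) :
    IsBox (extensionBound i f e) := by
  refine ⟨extensionBound_nonneg i f e, fun a b hab ha => ?_, fun a ha ha' => ?_⟩
  · refine le_of_forall_lt fun s hs => ?_
    obtain ⟨j, hj⟩ := exists_of_lt_extensionBound (s := max 0 (s - 1)) (le_max_left _ _)
      (max_lt ha (by linarith))
    have h1 := le_max_left 0 (s - 1)
    have h2 := le_max_right 0 (s - 1)
    have h3 := dist_nonneg (x := i j) (y := e)
    have := (f j).isPoint_levels.depth_add_one_le hab (by linarith)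
    linarith [le_extensionBound hi hf e b j]
  · by_contra! hcon
    -- Suprema need not be attained, so `j` and then `k` are chosen such that their individual
    -- bounds at `a` and `star a` are positive and still sum to more than `1`. This contradicts
    -- `depth_add_depth_star_le`, as `f j` and `f k` are at distance at most `dist (i j) e + dist (i
    -- k) e`.
    obtain ⟨j, hj⟩ := exists_of_lt_extensionBound
      (s := max 0 (1 - extensionBound i f e (star a))) (le_max_left _ _)
      (max_lt ha (by linarith))
    have hj0 := (le_max_left _ _).trans_lt hj
    have hj1 := (le_max_right _ _).trans_lt hj
    obtain ⟨k, hk⟩ := exists_of_lt_extensionBound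
      (s := max 0 (1 - (depth (f j).levels a - dist (i j) e))) (le_max_left _ _)
      (max_lt ha' (by linarith))
    have hk0 := (le_max_left _ _).trans_lt hk
    have hk1 := (le_max_right _ _).trans_lt hk
    have h3 := dist_nonneg (x := i j) (y := e)
    have h4 := dist_nonneg (x := i k) (y := e)
    have := (f j).isPoint_levels.depth_add_depth_star_le star_lt_star_active (f k).isPoint_levels
      (depth_le_depth_add_dist (f j) (f k)) (a := a) (by linarith) (by linarith)
    have h2 := hf.dist_le_mul j k
    have h5 := hi.dist_eq j k
    have h6 := dist_triangle_right (i j) (i k) e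
    rw [NNReal.coe_one, one_mul] at h2
    linarith

theorem extensionBound_apply (hi : Isometry i) (hf : LipschitzWith 1 f) (j : A)
    (a : ActiveElem B) : extensionBound i f (i j) a = depth (f j).levels a := by
  apply le_antisymm
  · by_contra! h
    obtain ⟨k, hk⟩ := exists_of_lt_extensionBound
      (depth_nonneg (f j).isPoint_levels.nonneg a) h
    have h1 := depth_le_depth_add_dist (f k) (f j) a
    have h2 := hf.dist_le_mul k j
    have h3 := hi.dist_eq k j
    rw [NNReal.coe_one, one_mul] at h2
    linarith
  · simpa using le_extensionBound hi hf (i j) a j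

end Extension

end Cubing

end PocSet

end

theorem mainTheorem3 (P : Type u) [PocSet P] (hP : PocSet.IsDiscrete P)
    (B : PocSet.Ultra P) (hfin : Finite (PocSet.Cube B)) :
    IsInjectiveMetricSpace.{u, v, w} (PocSet.Cubing B) := by
  intro A E _ _ i f hi hf
  have := PocSet.finite_active (B := B)
  have hS := PocSet.star_lt_star_active (B := B)
  have hbox := PocSet.isBox_extensionBound hi hf
  have ho := (PocSet.basePoint B).isPoint_levels
  have hpt := fun e => (hbox e).isPoint_gate hS ho
  choose F hF using fun e => PocSet.exists_levels_eq_of_isPoint (hpt e)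
  refine ⟨F, LipschitzWith.mk_one fun e e' => ?_, funext fun j => ?_⟩
  -- The point `y` within `dist e e'` of `F e` has the levels of `F e'`, hence equals it.
  · obtain ⟨y, hy, hd⟩ := PocSet.exists_levels_eq (F e) (hpt e') (dist_nonneg (x := e) (y := e'))
      (by
        rw [hF]
        exact (hbox e).depth_gate_sub_le hS (hbox e') ho
          (PocSet.extensionBound_le_add_dist hi hf e e') fun a => by
            rw [dist_comm]
            exact PocSet.extensionBound_le_add_dist hi hf e' e a)
    rwa [PocSet.Cubing.levels_injective (hy.trans (hF e').symm)] at hd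
  · exact PocSet.Cubing.levels_injective ((hF (i j)).trans
      (PocSet.gate_depth (f j).isPoint_levels (PocSet.extensionBound_apply hi hf j)))
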